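/- **Lemma** ($\mathsf{JI}\circ\mathsf{RWKL}' \equiv_{\mathrm c} \mathsf{RCOH}$). A *problem* is a subset $\mathsf P$ of $2^\omega\times 2^\omega$; $X$ is an *instance* of $\mathsf P$ if $\mathsf P(X,Y)$ holds for some $Y$, and each such $Y$ is a *solution* to $X$. Mathematical objects such as sequences of sets, finite strings and functions are coded by elements of $2^\omega$ in the standard computable way. We write $\mathsf P\le_{\mathrm c}\mathsf Q$ if every instance $X$ of $\mathsf P$ computes an instance $\widehat X$ of $\mathsf Q$ such that, for every solution $\widehat Y$ to $\widehat X$, $X\oplus\widehat Y$ computes a solution to $X$; and $\mathsf P\equiv_{\mathrm c}\mathsf Q$ if $\mathsf P\le_{\mathrm c}\mathsf Q$ and $\mathsf Q\le_{\mathrm c}\mathsf P$. * $\mathsf{RCOH}$: an instance is any sequence $\vec R=\langle R_0,R_1,\dots\rangle$ of subsets of $\omega$. A solution is an infinite set $C\subseteq\omega$ such that for infinitely many $n$ either $C\subseteq^* R_n$ or $C\subseteq^*\overline{R_n}$, where $A\subseteq^* B$ means that $A\setminus F\subseteq B$ for some finite set $F$. * $\mathsf{JI}\circ\mathsf{RWKL}'$: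 an instance is any function $g:2^{<\omega}\times\omega\to 2$ such that $\lim_s g(\sigma,s)$ exists for all $\sigma\in 2^{<\omega}$ and $T=\{\sigma:\lim_s g(\sigma,s)=1\}$ is an infinite tree (that is, infinite and closed under initial segments). A solution is a function $f:\omega^2\to 2$ such that $\lim_s f(x,s)$ exists for all $x$ and $H=\{x:\lim_s f(x,s)=1\}$ is an infinite homogeneous set for $T$; that is, $H$ is infinite and there are infinitely many $\sigma\in T$ such that, for some $i<2$, $\sigma(x)=i$ for all $x<|\sigma|$ with $x\in H$. Then $\mathsf{JI}\circ\mathsf{RWKL}'\equiv_{\mathrm c}\mathsf{RCOH}$; that is, $\mathsf{JI}\circ\mathsf{RWKL}'\le_{\mathrm c}\mathsf{RCOH}$ and $\mathsf{RCOH}\le_{\mathrm c}\mathsf{JI}\circ\mathsf{RWKL}'$. -/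

import Mathlib

namespace RamseyCoh

/-! ### Problems and computable reducibility -/

/-- Elements of `2^ω`, identified with subsets of `ω`. -/
abbrev Cantor : Type := ℕ → Bool

/-- The subset of `ω` with characteristic function `X`. -/
def toSet (X : Cantor) : Set ℕ := {n | X n = true}

/-- A problem is a subset of `2^ω × 2^ω`. -/
abbrev Problem : Type := Set (Cantor × Cantor)

/-- `Y` is a solution to `X` as an instance of `P`. -/
def Problem.IsSolution (P : Problem) (X Y : Cantor) : Prop := (X, Y) ∈ P

/-- `X` is an instance of `P` if some `Y` is a solution to it. -/
def Problem.IsInstance (P : Problem) (X : Cantor) : Prop := ∃ Y, P.IsSolution X Y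

/-- The characteristic function of `X`, with values `0` and `1`, as a function on numbers. -/
def charFun (X : Cantor) : ℕ →. ℕ := fun n => Part.some (X n).toNat

/-- `X` computes `Y`, that is, `Y` is Turing reducible to `X`. -/
def Computes (X Y : Cantor) : Prop := TuringReducible (charFun Y) (charFun X)

/-- The join `X ⊕ Y`: `X` on the even numbers and `Y` on the odd numbers. -/
def join (X Y : Cantor) : Cantor := fun n => if n % 2 = 0 then X (n / 2) else Y (n / 2)

/-- Computable reducibility `P ≤_c Q`. -/
def CompReducible (P Q : Problem) : Prop :=
  ∀ X, P.IsInstance X → ∃ X', Computes X X' ∧ Q.IsInstance X' ∧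
    ∀ Y', Q.IsSolution X' Y' → ∃ Y, Computes (join X Y') Y ∧ P.IsSolution X Y

/-- Computable equivalence `P ≡_c Q`. -/
def CompEquiv (P Q : Problem) : Prop := CompReducible P Q ∧ CompReducible Q P

/-- `Q ∘ P`: the solutions to `X` are the `Q`-solutions of the `P`-solutions to `X`. -/
def Problem.comp (Q P : Problem) : Problem :=
  {p | ∃ Y, P.IsSolution p.1 Y ∧ Q.IsSolution Y p.2}

/-! ### The Ramsey-type cohesiveness principle -/

/-- `A ⊆* B`: there is a finite set `F` with `A \ F ⊆ B`. -/
def AlmostSubset (A B : Set ℕ) : Prop := ∃ F : Set ℕ, F.Finite ∧ A \ F ⊆ B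

/-- `C` is Ramsey-cohesive for the sequence of sets `R`. -/
def RamseyCohesive (R : ℕ → Set ℕ) (C : Set ℕ) : Prop :=
  {n | AlmostSubset C (R n) ∨ AlmostSubset C (R n)ᶜ}.Infinite

/-- The sequence of sets coded by `X`: the `n`-th one is `{x : ⟨n, x⟩ ∈ X}`. -/
def seqOfSets (X : Cantor) (n : ℕ) : Set ℕ := {x | X (Nat.pair n x) = true}

/-- `RCOH`: every sequence of sets has an infinite Ramsey-cohesive set. -/
def RCOH : Problem :=
  {p | (toSet p.2).Infinite ∧ RamseyCohesive (seqOfSets p.1) (toSet p.2)}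

/-! ### Trees given by limit approximations, and their homogeneous sets -/

/-- A binary tree: a set of strings in `2^{<ω}` that is closed under initial segments. -/
def IsTree (T : Set (List Bool)) : Prop := ∀ σ ∈ T, ∀ τ, τ <+: σ → τ ∈ T

/-- `H` is homogeneous for the string `σ`: for some `i < 2`, `σ(x) = i` for all `x < |σ|` in
`H`. -/
def HomogeneousForString (H : Set ℕ) (σ : List Bool) : Prop :=
  ∃ i : Bool, ∀ (x : ℕ) (hx : x < σ.length), x ∈ H → σ[x] = i

/-- `H` is homogeneous for the tree `T`. -/
def HomogeneousForTree (H : Set ℕ) (T : Set (List Bool)) : Prop :=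
  {σ | σ ∈ T ∧ HomogeneousForString H σ}.Infinite

/-- `lim_s h(s) = b`, in the discrete two-point space. -/
def HasLim (h : ℕ → Bool) (b : Bool) : Prop := ∀ᶠ s in Filter.atTop, h s = b

/-- The function `g : 2^{<ω} × ω → 2` coded by `X`, strings being coded by numbers. -/
def stringFun (X : Cantor) (σ : List Bool) (s : ℕ) : Bool := X (Nat.pair (Encodable.encode σ) s)

/-- The set `{σ : lim_s g(σ, s) = 1}`. -/
def limitTree (g : List Bool → ℕ → Bool) : Set (List Bool) := {σ | HasLim (g σ) true}

/-- `g` is a limit approximation of an infinite binary tree: all limits `lim_s g(σ, s)` exist,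
and `{σ : lim_s g(σ, s) = 1}` is an infinite tree. -/
def ApproximatesTree (g : List Bool → ℕ → Bool) : Prop :=
  (∀ σ, ∃ b, HasLim (g σ) b) ∧ IsTree (limitTree g) ∧ (limitTree g).Infinite

/-- `RWKL'`: every infinite binary tree that is given by a limit approximation has an infinite
homogeneous set. -/
def RWKL' : Problem :=
  {p | ApproximatesTree (stringFun p.1) ∧ (toSet p.2).Infinite ∧
    HomogeneousForTree (toSet p.2) (limitTree (stringFun p.1))}

/-- The function `f : ω² → 2` coded by `Y`. -/
def pairFun (Y : Cantor) (x s : ℕ) : Bool := Y (Nat.pair x s)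

/-- `JI`: given `X`, find `f : ω² → 2` with `lim_s f(x, s) = X(x)` for all `x`. -/
def JI : Problem := {p | ∀ x, HasLim (pairFun p.2 x) (p.1 x)}

end RamseyCoh

/-! Both reductions exchange paths of a tree for membership patterns of a sequence of sets. From
trees to sequences: at stage `s` let `σ_s` be a longest string that appears to be in `T`, and put
`s` into `R_x` when `σ_s(x) = 1`. For each `n`, all but finitely many `s` have `σ_s ↾ n ∈ T`
(`eventually_branchSequence`). If `C` is Ramsey-cohesive for `R`, then for some colour `i`
infinitely many `x` satisfy `σ_s(x) = i` for almost all `s ∈ C`. These `x` form a `Σ⁰₂` set relative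
to `X ⊕ C`, and `exists_limit_subset` extracts an infinite limit-computable subset `H`. Late
elements of `C` witness that `H` is homogeneous for `T`. From sequences to trees: the patterns
`(R_x(y))_{x < n}` with `y ≥ n` form an infinite tree that is c.e. in `X`, hence limit computable.
Given an approximation to a homogeneous set `H` with colour `i`, search for each `n` for a `t` with
`R_x(t) = i` at all `x < n` that are in `H` according to some stage `s ≥ n`. The search succeeds
(`exists_agreesAt`), and for a fixed `x ∈ H` the approximation is eventually right, so almost all of
the numbers found satisfy `R_x(t) = i`. -/

namespace RamseyCoh

/-! ### Predicates decidable relative to an oracle -/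

section Oracle

variable {α β γ : Type*} [Primcodable α] [Primcodable β] [Primcodable γ]

theorem computableIn_comp {O : Set (ℕ →. ℕ)} {g : β → γ} {f : α → β}
    (hg : ComputableIn O g) (hf : ComputableIn O f) : ComputableIn O fun a => g (f a) :=
  (Nat.RecursiveIn.comp hg hf).of_eq fun n => by
    cases Encodable.decode (α := α) n <;> simp [Encodable.encodek]

theorem computableIn_pair {O : Set (ℕ →. ℕ)} {f : α → β} {g : α → γ}
    (hf : ComputableIn O f) (hg : ComputableIn O g) : ComputableIn O fun a => (f a, g a) :=
  (Nat.RecursiveIn.pair hf hg).of_eq fun n => by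
    cases Encodable.decode (α := α) n <;> simp [Seq.seq]

/-- The predicate `p` is decidable with oracle `Z`. -/
def DecidableIn (Z : Cantor) (p : α → Prop) : Prop :=
  ∃ b : α → Bool, ComputableIn {charFun Z} b ∧ ∀ a, b a = true ↔ p a

namespace DecidableIn

variable {Z : Cantor} {p q : α → Prop}

theorem of_eq (hp : DecidableIn Z p) (h : ∀ a, p a ↔ q a) : DecidableIn Z q :=
  let ⟨b, hb, e⟩ := hp
  ⟨b, hb, fun a => (e a).trans (h a)⟩

theorem of_primrecPred (hp : PrimrecPred p) : DecidableIn Z p :=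
  let ⟨_, h⟩ := hp
  ⟨fun a => decide (p a), h.computableIn, fun a => by simp⟩

theorem comp {p : β → Prop} (hp : DecidableIn Z p) {f : α → β} (hf : Primrec f) :
    DecidableIn Z fun a => p (f a) :=
  let ⟨_, hb, e⟩ := hp
  ⟨_, computableIn_comp hb hf.computableIn, fun a => e (f a)⟩

theorem not (hp : DecidableIn Z p) : DecidableIn Z fun a => ¬ p a :=
  let ⟨b, hb, e⟩ := hp
  ⟨fun a => !b a, computableIn_comp Primrec.not.computableIn hb, fun a => by simp [← e a]⟩

theorem and (hp : DecidableIn Z p) (hq : DecidableIn Z q) : DecidableIn Z fun a => p a ∧ q a :=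
  let ⟨b, hb, e⟩ := hp
  let ⟨c, hc, e'⟩ := hq
  ⟨fun a => b a && c a,
    computableIn_comp (g := fun x : Bool × Bool => x.1 && x.2)
      Primrec.and.computableIn (computableIn_pair hb hc),
    fun a => by simp [← e a, ← e' a]⟩

theorem imp (hp : DecidableIn Z p) (hq : DecidableIn Z q) : DecidableIn Z fun a => p a → q a :=
  (hp.and hq.not).not.of_eq fun a => by tauto

theorem iff (hp : DecidableIn Z p) (hq : DecidableIn Z q) : DecidableIn Z fun a => (p a ↔ q a) :=
  ((hp.imp hq).and (hq.imp hp)).of_eq fun a => by tauto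

/-- Primitive recursion on the truth value: the step function `h` keeps the value 1 only if the
accumulated value is 1 and the next instance holds. -/
theorem forall_lt_nat {p : ℕ × ℕ → Prop} (hp : DecidableIn Z p) :
    DecidableIn Z fun a : ℕ × ℕ => ∀ k < a.2, p (a.1, k) := by
  classical
  obtain ⟨b, hb, e⟩ := hp
  let h : ℕ → ℕ := fun n =>
    if n.unpair.2.unpair.2 = 1 ∧ b (n.unpair.1, n.unpair.2.unpair.1) = true then 1 else 0
  have hh : Nat.RecursiveIn {charFun Z} (h : ℕ →. ℕ) := by
    have h₁ : PrimrecPred fun n : ℕ => n.unpair.2.unpair.2 = 1 :=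
      Primrec.eq.comp (Primrec.snd.comp (Primrec.unpair.comp
        (Primrec.snd.comp Primrec.unpair))) (Primrec.const 1)
    have h₂ : DecidableIn Z fun n : ℕ => b (n.unpair.1, n.unpair.2.unpair.1) = true :=
      ⟨_, computableIn_comp hb (Primrec.pair (Primrec.fst.comp Primrec.unpair)
        (Primrec.fst.comp (Primrec.unpair.comp
          (Primrec.snd.comp Primrec.unpair)))).computableIn, fun _ => Iff.rfl⟩
    obtain ⟨c, hc, ec⟩ := (DecidableIn.of_primrecPred h₁).and h₂
    have h₃ : ComputableIn {charFun Z} fun n => (c n).toNat :=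
      computableIn_comp (Primrec.dom_finite _).computableIn hc
    refine (RecursiveIn.iff_nat.1 h₃).of_eq fun n => ?_
    have := ec n
    by_cases hn : c n = true
    · simp [h, hn, this.1 hn]
    · rw [this] at hn
      simp only [h, PFun.coe_val, if_neg hn]
      rw [← this] at hn
      simp [hn]
  have h₁ : Nat.RecursiveIn {charFun Z} ((fun _ => 1 : ℕ → ℕ) : ℕ →. ℕ) :=
    RecursiveIn.iff_nat.1 (ComputableIn.const (α := ℕ) (1 : ℕ))
  have key : ∀ a n : ℕ, (Nat.rec (Part.some 1) (fun y IH => IH.bind fun i =>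
      (h : ℕ →. ℕ) (Nat.pair a (Nat.pair y i))) n : Part ℕ) =
      Part.some (decide (∀ k < n, p (a, k))).toNat := by
    intro a n
    induction n with
    | zero => simp
    | succ n ih =>
      change Part.bind _ _ = _
      rw [ih]
      simp only [Part.bind_some, PFun.coe_val, h, Nat.unpair_pair, e]
      have hs := Nat.forall_lt_succ_right (p := fun k => p (a, k)) (n := n)
      by_cases h₁ : ∀ k < n, p (a, k)
      · by_cases h₂ : p (a, n)
        · rw [decide_eq_true h₁, decide_eq_true (hs.2 ⟨h₁, h₂⟩)]
          simp [h₂]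
        · rw [decide_eq_true h₁, decide_eq_false fun H => h₂ (hs.1 H).2]
          simp [h₂]
      · rw [decide_eq_false h₁, decide_eq_false fun H => h₁ (hs.1 H).1]
        simp
  refine ⟨fun a => decide (∀ k < a.2, p (a.1, k)), ?_, fun a => by simp⟩
  refine (Nat.RecursiveIn.prec h₁ hh).of_eq fun n => ?_
  refine (key n.unpair.1 n.unpair.2).trans ?_
  simp
  cases decide (∀ k < n.unpair.2, p (n.unpair.1, k)) <;> rfl

theorem forall_lt [Inhabited α] {p : α → ℕ → Prop} (hp : DecidableIn Z fun a : α × ℕ => p a.1 a.2)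
    {f : α → ℕ} (hf : Primrec f) : DecidableIn Z fun a => ∀ k < f a, p a k := by
  -- The default is irrelevant: the first component will always be a code `encode a`.
  have h : Primrec fun a : ℕ × ℕ => ((Encodable.decode (α := α) a.1).getD default, a.2) :=
    Primrec.pair (Primrec.option_getD.comp (Primrec.decode.comp Primrec.fst)
      (Primrec.const default)) Primrec.snd
  exact ((hp.comp h).forall_lt_nat.comp (Primrec.pair Primrec.encode hf)).of_eq fun a => by
    simp [Encodable.encodek]

theorem exists_lt [Inhabited α] {p : α → ℕ → Prop} (hp : DecidableIn Z fun a : α × ℕ => p a.1 a.2)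
    {f : α → ℕ} (hf : Primrec f) : DecidableIn Z fun a => ∃ k < f a, p a k :=
  (DecidableIn.forall_lt (p := fun a k => ¬ p a k) hp.not hf).not.of_eq fun a => by simp

theorem computes {p : ℕ → Prop} [DecidablePred p] (hp : DecidableIn Z p) :
    Computes Z fun n => decide (p n) := by
  obtain ⟨b, hb, e⟩ := hp
  refine (computableIn_comp (Primrec.dom_finite Bool.toNat).computableIn hb).of_eq fun n => ?_
  have : b n = decide (p n) := by rw [Bool.eq_iff_iff, e]; simp
  simp [charFun, this]

theorem oracle (Z : Cantor) : DecidableIn Z fun n => Z n = true := by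
  have h : ComputableIn {charFun Z} fun n => (Z n).toNat := RecursiveIn.oracle _ rfl
  refine ⟨_, computableIn_comp (g := fun n : ℕ => decide (n = 1))
    (Primrec.eq.comp Primrec.id (Primrec.const 1)).decide.computableIn h, fun n => ?_⟩
  cases h : Z n <;> simp [h]

theorem subst {Y : Cantor} (hp : DecidableIn Y p) (h : Computes Z Y) : DecidableIn Z p :=
  let ⟨b, hb, e⟩ := hp
  ⟨b, RecursiveIn.subst hb (by rintro _ rfl; exact h), e⟩

end DecidableIn

theorem Computes.decidableIn {Z Y : Cantor} (h : Computes Z Y) :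
    DecidableIn Z fun n => Y n = true :=
  (DecidableIn.oracle Y).subst h

theorem DecidableIn.apply_eq {Z Y : Cantor} (h : DecidableIn Z fun n => Y n = true) (i : Bool) :
    DecidableIn Z fun n => Y n = i := by
  cases i
  · exact h.not.of_eq fun n => by simp
  · exact h

theorem computes_join_left (X Y : Cantor) : Computes (join X Y) X := by
  have := ((DecidableIn.oracle (join X Y)).comp
    (Primrec.nat_mul.comp (Primrec.const 2) Primrec.id)).computes
  simpa [join] using this

theorem computes_join_right (X Y : Cantor) : Computes (join X Y) Y := by
  have := ((DecidableIn.oracle (join X Y)).comp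
    (Primrec.succ.comp (Primrec.nat_mul.comp (Primrec.const 2) Primrec.id))).computes
  convert this using 2 with n
  have h₁ : (2 * n + 1) % 2 = 1 := by omega
  have h₂ : (2 * n + 1) / 2 = n := by omega
  simp [join, h₁, h₂]

end Oracle

open Filter

/-! ### Combinatorial lemmas -/

/-- Every sequence of sets has arbitrarily large elements realizing the initial segments of a
fixed pattern. -/
theorem exists_pattern (R : ℕ → Set ℕ) :
    ∃ P : ℕ → Bool, ∀ n, ∃ y, n ≤ y ∧ ∀ x < n, (y ∈ R x ↔ P x = true) := by
  classical
  let U := hyperfilter ℕ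
  refine ⟨fun x => decide (R x ∈ U), fun n => ?_⟩
  have h₁ : ∀ᶠ y in (U : Filter ℕ), n ≤ y :=
    Nat.hyperfilter_le_atTop (eventually_ge_atTop n)
  have h₂ : ∀ᶠ y in (U : Filter ℕ), ∀ x ∈ Set.Iio n, (y ∈ R x ↔ decide (R x ∈ U) = true) := by
    rw [eventually_all_finite (Set.finite_Iio n)]
    intro x _
    by_cases hx : R x ∈ U
    · filter_upwards [hx] with y hy
      simp [hx, hy]
    · filter_upwards [Ultrafilter.compl_mem_iff_notMem.2 hx] with y hy
      simpa [hx] using hy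
  obtain ⟨y, hy⟩ := (h₁.and h₂).exists
  exact ⟨y, hy⟩

theorem RCOH_isInstance (X : Cantor) : RCOH.IsInstance X := by
  classical
  obtain ⟨P, hP⟩ := exists_pattern (seqOfSets X)
  choose y hy hyP using hP
  have hC : toSet (fun n => decide (n ∈ Set.range y)) = Set.range y := by
    ext n; simp [toSet]
  refine ⟨fun n => decide (n ∈ Set.range y), ?_, ?_⟩
  · rw [hC]
    exact Set.infinite_of_forall_exists_gt fun n => ⟨y (n + 1), ⟨_, rfl⟩, hy (n + 1)⟩
  · rw [hC]
    refine Set.infinite_univ.mono fun n _ => ?_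
    -- `y m` follows the pattern at `n` as soon as `n < m`, so only the images of `m ≤ n` are
    -- discarded.
    have key : ∀ z ∈ Set.range y \ y '' Set.Iic n, (z ∈ seqOfSets X n ↔ P n = true) := by
      rintro _ ⟨⟨m, rfl⟩, hm⟩
      exact hyP m n (not_le.1 fun h => hm ⟨m, h, rfl⟩)
    by_cases h : P n = true
    · exact Or.inl ⟨_, (Set.finite_Iic n).image y, fun z hz => (key z hz).2 h⟩
    · exact Or.inr ⟨_, (Set.finite_Iic n).image y, fun z hz hz' => h ((key z hz).1 hz')⟩

theorem infinite_of_forall_length {S : Set (List Bool)} (h : ∀ n, ∃ σ ∈ S, σ.length = n) :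
    S.Infinite :=
  Set.Infinite.of_image List.length <| Set.infinite_univ.mono fun n _ => h n

theorem exists_length_ge_of_infinite {S : Set (List Bool)} (h : S.Infinite) (n : ℕ) :
    ∃ σ ∈ S, n ≤ σ.length := by
  by_contra! H
  exact h ((List.finite_length_lt Bool n).subset H)

theorem IsTree.exists_length_eq {T : Set (List Bool)} (hT : IsTree T) (h : T.Infinite) (n : ℕ) :
    ∃ σ ∈ T, σ.length = n := by
  obtain ⟨σ, hσ, hn⟩ := exists_length_ge_of_infinite h n
  exact ⟨σ.take n, hT σ hσ _ (List.take_prefix n σ), by simpa using hn⟩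

theorem exists_infinite_eq {S : Set ℕ} (hS : S.Infinite) {q : Bool → ℕ → Prop}
    (h : ∀ x ∈ S, ∃ i, q i x) : ∃ i, {x | q i x}.Infinite := by
  by_contra! H
  refine hS (((H true).union (H false)).subset fun x hx => ?_)
  obtain ⟨i, hi⟩ := h x hx
  cases i
  exacts [Or.inr hi, Or.inl hi]

theorem JI_isSolution_const (H : Cantor) : JI.IsSolution H fun n => H n.unpair.1 := by
  intro x
  simp [HasLim, pairFun]

/-- An infinite set that is `Σ⁰₂` relative to `Z` has an infinite subset with an approximation
computable in `Z`. -/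
theorem exists_limit_subset {Z : Cantor} {p : ℕ → ℕ → Prop}
    (hp : DecidableIn Z fun a : ℕ × ℕ => p a.1 a.2)
    (hinf : {x | ∃ m, ∀ k, p (Nat.pair x m) k}.Infinite) :
    ∃ Y H, Computes Z Y ∧ JI.IsSolution H Y ∧ (toSet H).Infinite ∧
      ∀ x ∈ toSet H, ∃ m, ∀ k, p (Nat.pair x m) k := by
  classical
  -- The subset consists of the record values: first components of pairs `e` in `A` that exceed
  -- those of all earlier members of `A`. Replacing `A` by its stage-`s` approximation makes this
  -- decidable.
  let q : ℕ → (ℕ → Prop) → Prop := fun x A =>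
    ∃ e, A e ∧ e.unpair.1 = x ∧ ∀ e' < e, A e' → e'.unpair.1 < x
  let A : ℕ → Prop := fun e => ∀ k, p e k
  have hA : ∀ n, ∃ e, A e ∧ n ≤ e.unpair.1 := fun n => by
    obtain ⟨x, ⟨m, hm⟩, hx⟩ := hinf.exists_gt n
    exact ⟨Nat.pair x m, hm, by simpa using hx.le⟩
  let r : ℕ → ℕ → ℕ → Prop := fun x s e => (∀ k < s, p e k) ∧ e.unpair.1 = x ∧
    ∀ e' < e, (∀ k < s, p e' k) → e'.unpair.1 < x
  have hr : DecidableIn Z fun n : ℕ => ∃ e < n.unpair.2, r n.unpair.1 n.unpair.2 e := by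
    have u₁ : Primrec fun n : ℕ => n.unpair.1 := Primrec.fst.comp Primrec.unpair
    have u₂ : Primrec fun n : ℕ => n.unpair.2 := Primrec.snd.comp Primrec.unpair
    have hAs : DecidableIn Z fun a : ℕ × ℕ => ∀ k < a.1, p a.2 k :=
      DecidableIn.forall_lt (p := fun a k => p a.2 k)
        (hp.comp (Primrec.pair (Primrec.snd.comp Primrec.fst) Primrec.snd)) Primrec.fst
    refine DecidableIn.exists_lt (p := fun n e => r n.unpair.1 n.unpair.2 e) ?_ u₂
    refine (hAs.comp (Primrec.pair (u₂.comp Primrec.fst) Primrec.snd)).and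
      ((DecidableIn.of_primrecPred (Primrec.eq.comp (u₁.comp Primrec.snd)
        (u₁.comp Primrec.fst))).and ?_)
    refine DecidableIn.forall_lt (p := fun (a : ℕ × ℕ) e' =>
      (∀ k < a.1.unpair.2, p e' k) → e'.unpair.1 < a.1.unpair.1) ?_ Primrec.snd
    exact (hAs.comp (Primrec.pair (u₂.comp (Primrec.fst.comp Primrec.fst)) Primrec.snd)).imp
      (DecidableIn.of_primrecPred (Primrec.nat_lt.comp (u₁.comp Primrec.snd)
        (u₁.comp (Primrec.fst.comp Primrec.fst))))
  refine ⟨_, fun x => decide (q x A), hr.computes, fun x => ?_, ?_, ?_⟩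
  · obtain ⟨he, hxe⟩ := Nat.find_spec (hA x)
    have hmin : ∀ e' < Nat.find (hA x), A e' → e'.unpair.1 < x := fun e' h h' =>
      not_le.1 fun h'' => Nat.find_min (hA x) h ⟨h', h''⟩
    generalize Nat.find (hA x) = e at he hxe hmin
    -- Here `e` is the least member of `A` with first component at least `x`; eventually every false
    -- member below `e` has been refuted.
    have hs : ∀ᶠ s in atTop, ∀ e' ∈ Set.Iio e, (∀ k < s, p e' k) → A e' := by
      rw [eventually_all_finite (Set.finite_Iio e)]
      intro e' _
      by_cases h : A e'
      · exact .of_forall fun _ _ => h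
      · obtain ⟨k, hk⟩ := not_forall.1 h
        filter_upwards [eventually_gt_atTop k] with s hs H
        exact absurd (H k hs) hk
    filter_upwards [hs, eventually_gt_atTop e] with s hs hes
    simp only [pairFun, Nat.unpair_pair]
    rw [decide_eq_decide]
    -- A candidate `e₁ < e` has too small a first component, and one above `e` is blocked by `e`
    -- itself.
    constructor
    · rintro ⟨e₁, -, h₁, h₂, h₃⟩
      rcases lt_trichotomy e₁ e with h | rfl | h
      · exact absurd (hmin _ h (hs _ h h₁)) h₂.not_lt
      · exact ⟨e₁, he, h₂, hmin⟩
      · exact absurd (h₃ e h fun k _ => he k) hxe.not_gt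
    · rintro ⟨e₁, h₁, h₂, h₃⟩
      rcases lt_trichotomy e₁ e with h | rfl | h
      · exact absurd (hmin _ h h₁) h₂.not_lt
      · exact ⟨e₁, hes, fun k _ => he k, h₂, fun e' h h' => hmin e' h (hs e' h h')⟩
      · exact absurd (h₃ e h he) hxe.not_gt
  · refine Set.infinite_of_forall_exists_gt fun n => ?_
    obtain ⟨he, hne⟩ := Nat.find_spec (hA (n + 1))
    refine ⟨_, ?_, hne⟩
    simp only [toSet, Set.mem_ofPred_eq, decide_eq_true_eq]
    exact ⟨_, he, rfl, fun e' h h' => lt_of_lt_of_le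
      (not_le.1 fun h'' => Nat.find_min (hA (n + 1)) h ⟨h', h''⟩) hne⟩
  · intro x hx
    simp only [toSet, Set.mem_ofPred_eq, decide_eq_true_eq] at hx
    obtain ⟨e, he, rfl, -⟩ := hx
    exact ⟨e.unpair.2, by simpa using he⟩

/-- The string with code `e`. -/
def codedString (e : ℕ) : List Bool := (Encodable.decode e).getD []

theorem codedString_encode (σ : List Bool) : codedString (Encodable.encode σ) = σ := by
  simp [codedString]

theorem primrec_codedString : Primrec codedString :=
  Primrec.option_getD.comp Primrec.decode (Primrec.const [])

theorem primrec_codedString_length : Primrec fun e => (codedString e).length :=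
  Primrec.list_length.comp primrec_codedString

theorem primrecPred_codedString_getD :
    PrimrecPred fun a : ℕ × ℕ => (codedString a.1).getD a.2 false = true :=
  Primrec.eq.comp ((Primrec.list_getD false).comp (primrec_codedString.comp Primrec.fst) Primrec.snd)
    (Primrec.const true)

/-! ### From trees to sequences of sets -/

/-- At stage `s`, all initial segments of the string with code `e` appear to be in the tree that
is approximated by `X`. -/
def AppearsInTree (X : Cantor) (s e : ℕ) : Prop :=
  ∀ n < (codedString e).length + 1, stringFun X ((codedString e).take n) s = true

/-- The code `e < s` is the least code of a string of maximal length among the strings with code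
below `s` that appear to be in the tree at stage `s`. -/
def IsLeastLongest (X : Cantor) (s e : ℕ) : Prop :=
  AppearsInTree X s e ∧ ∀ e' < s, AppearsInTree X s e' →
    (codedString e').length < (codedString e).length ∨
      ((codedString e').length = (codedString e).length ∧ e ≤ e')

open Classical in
/-- The sequence whose `x`-th set consists of the stages `s` at which the least longest string
apparently in the tree has the value `1` at `x`. -/
noncomputable def branchSequence (X : Cantor) : Cantor := fun n =>
  decide (∃ e < n.unpair.2, IsLeastLongest X n.unpair.2 e ∧
    (codedString e).getD n.unpair.1 false = true)

theorem decidableIn_appearsInTree (X : Cantor) :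
    DecidableIn X fun a : ℕ × ℕ => AppearsInTree X a.1 a.2 := by
  refine DecidableIn.forall_lt (p := fun (a : ℕ × ℕ) n =>
    stringFun X ((codedString a.2).take n) a.1 = true) ?_
    (Primrec.succ.comp (primrec_codedString_length.comp Primrec.snd))
  exact (DecidableIn.oracle X).comp (Primrec₂.natPair.comp
    (Primrec.encode.comp (Primrec.list_take.comp Primrec.snd
      (primrec_codedString.comp (Primrec.snd.comp Primrec.fst))))
    (Primrec.fst.comp Primrec.fst))

theorem decidableIn_isLeastLongest (X : Cantor) :
    DecidableIn X fun a : ℕ × ℕ => IsLeastLongest X a.1 a.2 := by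
  refine (decidableIn_appearsInTree X).and ?_
  refine DecidableIn.forall_lt (p := fun (a : ℕ × ℕ) e' => AppearsInTree X a.1 e' →
    (codedString e').length < (codedString a.2).length ∨
      ((codedString e').length = (codedString a.2).length ∧ a.2 ≤ e')) ?_ Primrec.fst
  have l₁ : Primrec fun a : (ℕ × ℕ) × ℕ => (codedString a.2).length :=
    primrec_codedString_length.comp Primrec.snd
  have l₂ : Primrec fun a : (ℕ × ℕ) × ℕ => (codedString a.1.2).length :=
    primrec_codedString_length.comp (Primrec.snd.comp Primrec.fst)
  refine ((decidableIn_appearsInTree X).comp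
    (Primrec.pair (Primrec.fst.comp Primrec.fst) Primrec.snd)).imp (.of_primrecPred ?_)
  exact (Primrec.nat_lt.comp l₁ l₂).or ((Primrec.eq.comp l₁ l₂).and
    (Primrec.nat_le.comp (Primrec.snd.comp Primrec.fst) Primrec.snd))

theorem computes_branchSequence (X : Cantor) : Computes X (branchSequence X) := by
  classical
  have u₁ : Primrec fun n : ℕ => n.unpair.1 := Primrec.fst.comp Primrec.unpair
  have u₂ : Primrec fun n : ℕ => n.unpair.2 := Primrec.snd.comp Primrec.unpair
  have h : DecidableIn X fun n : ℕ => ∃ e < n.unpair.2, IsLeastLongest X n.unpair.2 e ∧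
      (codedString e).getD n.unpair.1 false = true := by
    refine DecidableIn.exists_lt (p := fun (n e : ℕ) => IsLeastLongest X n.unpair.2 e ∧
      (codedString e).getD n.unpair.1 false = true) ?_ u₂
    exact ((decidableIn_isLeastLongest X).comp
      (Primrec.pair (u₂.comp Primrec.fst) Primrec.snd)).and
      (.of_primrecPred (primrecPred_codedString_getD.comp
        (Primrec.pair Primrec.snd (u₁.comp Primrec.fst))))
  convert h.computes using 1
  exact funext fun n => decide_eq_decide.2 Iff.rfl

theorem exists_isLeastLongest {X : Cantor} {s e₀ : ℕ} (h : e₀ < s) (h₀ : AppearsInTree X s e₀) :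
    ∃ e < s, IsLeastLongest X s e ∧ (codedString e₀).length ≤ (codedString e).length := by
  classical
  obtain ⟨m, hm, hmax⟩ := Finset.exists_max_image
    ((Finset.range s).filter (AppearsInTree X s)) (fun e => (codedString e).length)
    ⟨e₀, by simp [h, h₀]⟩
  have hex : ∃ e, e < s ∧ AppearsInTree X s e ∧
      (codedString e).length = (codedString m).length := by
    simp only [Finset.mem_filter, Finset.mem_range] at hm
    exact ⟨m, hm.1, hm.2, rfl⟩
  obtain ⟨h₁, h₂, h₃⟩ := Nat.find_spec hex
  refine ⟨_, h₁, ⟨h₂, fun e' he' ha => ?_⟩, ?_⟩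
  · rw [h₃]
    rcases (hmax e' (by simp [he', ha])).lt_or_eq with hl | hl
    · exact Or.inl hl
    · exact Or.inr ⟨hl, Nat.find_min' hex ⟨he', ha, hl⟩⟩
  · rw [h₃]
    exact hmax e₀ (by simp [h, h₀])

theorem IsLeastLongest.unique {X : Cantor} {s e e' : ℕ} (he : e < s) (he' : e' < s)
    (h : IsLeastLongest X s e) (h' : IsLeastLongest X s e') : e = e' := by
  have h₁ := h.2 e' he' h'.1
  have h₂ := h'.2 e he h.1
  omega

theorem eventually_branchSequence {X : Cantor} (hX : ApproximatesTree (stringFun X)) (n : ℕ) :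
    ∀ᶠ s in atTop, ∃ σ ∈ limitTree (stringFun X), σ.length = n ∧
      ∀ (x : ℕ) (hx : x < σ.length), branchSequence X (Nat.pair x s) = σ[x] := by
  obtain ⟨hlim, hT, hinf⟩ := hX
  obtain ⟨τ, hτ, rfl⟩ := hT.exists_length_eq hinf n
  have h₁ : ∀ᶠ s in atTop, ∀ k ∈ Set.Iio (τ.length + 1), stringFun X (τ.take k) s = true := by
    rw [eventually_all_finite (Set.finite_Iio _)]
    exact fun k _ => hT τ hτ _ (List.take_prefix k τ)
  -- Only finitely many strings have this length, so those outside the tree are eventually all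
  -- rejected. The chosen string is at least this long, since `τ` competes, and its initial segment
  -- of this length appears in the tree, hence belongs to it.
  have h₂ : ∀ᶠ s in atTop, ∀ σ ∈ {σ : List Bool | σ.length = τ.length},
      stringFun X σ s = true → σ ∈ limitTree (stringFun X) := by
    rw [eventually_all_finite (List.finite_length_eq Bool _)]
    intro σ _
    obtain ⟨b, hb⟩ := hlim σ
    cases b
    · filter_upwards [hb] with s hs h
      simp [hs] at h
    · exact .of_forall fun _ _ => hb
  filter_upwards [h₁, h₂, eventually_gt_atTop (Encodable.encode τ)] with s h₁ h₂ hs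
  obtain ⟨e, hes, he, hle⟩ := exists_isLeastLongest (X := X) hs
    (by rw [AppearsInTree, codedString_encode]; exact h₁)
  rw [codedString_encode] at hle
  have hlen : ((codedString e).take τ.length).length = τ.length := by simpa using hle
  refine ⟨_, h₂ _ hlen (he.1 _ (by omega)), hlen, fun x hx => ?_⟩
  have hx' : x < (codedString e).length := by omega
  have : branchSequence X (Nat.pair x s) = (codedString e).getD x false := by
    rw [Bool.eq_iff_iff]
    simp only [branchSequence, Nat.unpair_pair, decide_eq_true_eq]
    constructor
    · rintro ⟨e', hes', he', h⟩
      rwa [he.unique hes hes' he']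
    · exact fun h => ⟨e, hes, he, h⟩
  rw [this, List.getElem_take, List.getD_eq_getElem _ _ hx']

theorem comp_JI_RWKL'_reducible_RCOH : CompReducible (JI.comp RWKL') RCOH := by
  rintro X ⟨_, _, ⟨hX, -, -⟩, -⟩
  refine ⟨branchSequence X, computes_branchSequence X, RCOH_isInstance _, ?_⟩
  rintro C ⟨hC, hcoh⟩
  have hXs := (computes_branchSequence X).decidableIn.subst (computes_join_left X C)
  -- Fix one colour for infinitely many indices; the finite exception set becomes a threshold `m`,
  -- which gives the `Σ⁰₂` form.
  obtain ⟨i, hi⟩ := exists_infinite_eq hcoh (q := fun i x => ∃ m, ∀ k, C k = true → m ≤ k →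
      branchSequence X (Nat.pair x k) = i) <| by
    rintro x (⟨F, hF, h⟩ | ⟨F, hF, h⟩)
    all_goals obtain ⟨m, hm⟩ := hF.bddAbove
    · refine ⟨true, m + 1, fun k hk hmk => h ⟨hk, fun hkF => ?_⟩⟩
      have := hm hkF
      omega
    · refine ⟨false, m + 1, fun k hk hmk => Bool.eq_false_iff.2 (h ⟨hk, fun hkF => ?_⟩)⟩
      have := hm hkF
      omega
  have hp : DecidableIn (join X C) fun a : ℕ × ℕ => C a.2 = true → a.1.unpair.2 ≤ a.2 →
      branchSequence X (Nat.pair a.1.unpair.1 a.2) = i := by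
    refine ((computes_join_right X C).decidableIn.comp Primrec.snd).imp
      ((DecidableIn.of_primrecPred (Primrec.nat_le.comp
        (Primrec.snd.comp (Primrec.unpair.comp Primrec.fst)) Primrec.snd)).imp ?_)
    exact (hXs.apply_eq i).comp (Primrec₂.natPair.comp
      (Primrec.fst.comp (Primrec.unpair.comp Primrec.fst)) Primrec.snd)
  obtain ⟨Y, H, hY, hJ, hH, hsub⟩ := exists_limit_subset (p := fun e k => C k = true →
    e.unpair.2 ≤ k → branchSequence X (Nat.pair e.unpair.1 k) = i) hp (by simpa using hi)
  simp only [Nat.unpair_pair] at hsub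
  refine ⟨Y, hY, H, ⟨hX, hH, infinite_of_forall_length fun n => ?_⟩, hJ⟩
  choose! m hm using hsub
  have hlate : ∀ᶠ s in atTop, ∀ x ∈ Set.Iio n, m x ≤ s := by
    rw [eventually_all_finite (Set.finite_Iio n)]
    exact fun x _ => eventually_ge_atTop _
  -- An element `s` of `C` past `N` exceeds all thresholds `m x` with `x < n`, so the string of
  -- length `n` it yields has value `i` on `H`.
  obtain ⟨N, hN⟩ := eventually_atTop.1 (hlate.and (eventually_branchSequence hX n))
  obtain ⟨s, hs, hNs⟩ := hC.exists_gt N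
  obtain ⟨hms, σ, hσ, rfl, hx⟩ := hN s hNs.le
  exact ⟨σ, ⟨hσ, i, fun x hxl hxH => (hx x hxl).symm.trans (hm x hxH s hs (hms x hxl))⟩, rfl⟩

/-! ### From sequences of sets to trees -/

open Classical in
/-- The approximation of the tree of all strings `σ` such that some `y ≥ |σ|` is in the `x`-th set
coded by `X` if and only if `σ(x) = 1`, for all `x < |σ|`. -/
noncomputable def patternApprox (X : Cantor) : Cantor := fun n =>
  decide (∃ y < n.unpair.2, (codedString n.unpair.1).length ≤ y ∧
    ∀ x < (codedString n.unpair.1).length,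
      (X (Nat.pair x y) = true ↔ (codedString n.unpair.1).getD x false = true))

theorem computes_patternApprox (X : Cantor) : Computes X (patternApprox X) := by
  classical
  have u₁ : Primrec fun n : ℕ => n.unpair.1 := Primrec.fst.comp Primrec.unpair
  have u₂ : Primrec fun n : ℕ => n.unpair.2 := Primrec.snd.comp Primrec.unpair
  have h : DecidableIn X fun n : ℕ => ∃ y < n.unpair.2, (codedString n.unpair.1).length ≤ y ∧
      ∀ x < (codedString n.unpair.1).length,
        (X (Nat.pair x y) = true ↔ (codedString n.unpair.1).getD x false = true) := by
    have l : Primrec fun a : ℕ × ℕ => (codedString a.1.unpair.1).length :=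
      primrec_codedString_length.comp (u₁.comp Primrec.fst)
    refine DecidableIn.exists_lt (p := fun (n y : ℕ) => (codedString n.unpair.1).length ≤ y ∧
      ∀ x < (codedString n.unpair.1).length,
        (X (Nat.pair x y) = true ↔ (codedString n.unpair.1).getD x false = true)) ?_ u₂
    refine (DecidableIn.of_primrecPred (Primrec.nat_le.comp l Primrec.snd)).and ?_
    refine DecidableIn.forall_lt (p := fun (a : ℕ × ℕ) x =>
      (X (Nat.pair x a.2) = true ↔ (codedString a.1.unpair.1).getD x false = true)) ?_ l
    exact ((DecidableIn.oracle X).comp (Primrec₂.natPair.comp Primrec.snd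
      (Primrec.snd.comp Primrec.fst))).iff
      (.of_primrecPred (primrecPred_codedString_getD.comp
        (Primrec.pair (u₁.comp (Primrec.fst.comp Primrec.fst)) Primrec.snd)))
  convert h.computes using 1
  exact funext fun n => decide_eq_decide.2 Iff.rfl

/-- The tree approximated by `patternApprox X`. -/
def patternTree (X : Cantor) : Set (List Bool) :=
  {σ | ∃ y, σ.length ≤ y ∧ ∀ (x : ℕ) (hx : x < σ.length), X (Nat.pair x y) = σ[x]}

theorem stringFun_patternApprox (X : Cantor) (σ : List Bool) (s : ℕ) :
    stringFun (patternApprox X) σ s = true ↔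
      ∃ y < s, σ.length ≤ y ∧ ∀ (x : ℕ) (hx : x < σ.length), X (Nat.pair x y) = σ[x] := by
  simp only [stringFun, patternApprox, Nat.unpair_pair, codedString_encode, decide_eq_true_eq,
    ← Bool.eq_iff_iff]
  refine exists_congr fun y => and_congr_right fun _ => and_congr_right fun _ =>
    forall_congr' fun x => forall_congr' fun hx => ?_
  rw [List.getD_eq_getElem _ _ hx]

theorem hasLim_true_of_mem_patternTree {X : Cantor} {σ : List Bool} (h : σ ∈ patternTree X) :
    HasLim (stringFun (patternApprox X) σ) true := by
  obtain ⟨y, hy⟩ := h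
  filter_upwards [eventually_gt_atTop y] with s hs
  exact (stringFun_patternApprox X σ s).2 ⟨y, hs, hy⟩

theorem hasLim_false_of_notMem_patternTree {X : Cantor} {σ : List Bool} (h : σ ∉ patternTree X) :
    HasLim (stringFun (patternApprox X) σ) false :=
  .of_forall fun s => Bool.eq_false_iff.2 fun hs =>
    let ⟨y, _, hy⟩ := (stringFun_patternApprox X σ s).1 hs
    h ⟨y, hy⟩

theorem limitTree_patternApprox (X : Cantor) :
    limitTree (stringFun (patternApprox X)) = patternTree X := by
  ext σ
  refine ⟨fun h => by_contra fun h' => ?_, hasLim_true_of_mem_patternTree⟩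
  obtain ⟨s, h₁, h₂⟩ := (h.and (hasLim_false_of_notMem_patternTree h')).exists
  simp [h₁] at h₂

theorem isTree_patternTree (X : Cantor) : IsTree (patternTree X) := by
  rintro σ ⟨y, hy, h⟩ τ hτ
  refine ⟨y, hτ.length_le.trans hy, fun x hx => ?_⟩
  rw [h x (hx.trans_le hτ.length_le), hτ.getElem hx]

theorem exists_branch_patternTree (X : Cantor) :
    ∃ P : ℕ → Bool, ∀ n, (List.range n).map P ∈ patternTree X := by
  obtain ⟨P, hP⟩ := exists_pattern (seqOfSets X)
  refine ⟨P, fun n => ?_⟩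
  obtain ⟨y, hy, h⟩ := hP n
  refine ⟨y, by simpa using hy, fun x hx => ?_⟩
  rw [Bool.eq_iff_iff]
  simpa [seqOfSets] using h x (by simpa using hx)

theorem approximatesTree_patternApprox (X : Cantor) :
    ApproximatesTree (stringFun (patternApprox X)) := by
  refine ⟨fun σ => ?_, ?_, ?_⟩
  · by_cases h : σ ∈ patternTree X
    · exact ⟨_, hasLim_true_of_mem_patternTree h⟩
    · exact ⟨_, hasLim_false_of_notMem_patternTree h⟩
  · rw [limitTree_patternApprox]
    exact isTree_patternTree X
  · rw [limitTree_patternApprox]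
    obtain ⟨P, hP⟩ := exists_branch_patternTree X
    exact infinite_of_forall_length fun n => ⟨_, hP n, by simp⟩

/-- A path through the tree takes some value infinitely often; the set where it does is homogeneous.
-/
theorem comp_JI_RWKL'_isInstance_patternApprox (X : Cantor) :
    (JI.comp RWKL').IsInstance (patternApprox X) := by
  obtain ⟨P, hP⟩ := exists_branch_patternTree X
  obtain ⟨i, hi⟩ := exists_infinite_eq Set.infinite_univ (q := fun i x => P x = i)
    fun x _ => ⟨P x, rfl⟩
  let H : Cantor := fun x => P x == i
  refine ⟨_, H, ⟨approximatesTree_patternApprox X, by simpa [toSet, H] using hi, ?_⟩,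
    JI_isSolution_const H⟩
  rw [HomogeneousForTree, limitTree_patternApprox]
  refine infinite_of_forall_length fun n => ⟨_, ⟨hP n, i, fun x hx hxH => ?_⟩, by simp⟩
  simpa [toSet, H] using hxH

/-- A homogeneous set for an infinite tree is homogeneous, with a fixed value, for strings in the
tree of all lengths. -/
theorem HomogeneousForTree.exists_value {T : Set (List Bool)} {H : Set ℕ}
    (h : HomogeneousForTree H T) (hT : IsTree T) :
    ∃ i : Bool, ∀ n, ∃ σ ∈ T, σ.length = n ∧
      ∀ (x : ℕ) (hx : x < σ.length), x ∈ H → σ[x] = i := by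
  by_contra! hcon
  -- If each colour failed at some length, a homogeneous string longer than both lengths could be
  -- cut down to contradict the failure of its own colour.
  choose n hn using hcon
  obtain ⟨σ, ⟨hσ, i, hi⟩, hlen⟩ := exists_length_ge_of_infinite h (max (n true) (n false))
  have hni : n i ≤ σ.length := by cases i <;> omega
  obtain ⟨x, hx, hxH, hne⟩ := hn i (σ.take (n i)) (hT σ hσ _ (List.take_prefix _ σ))
    (by simpa using hni)
  rw [List.getElem_take] at hne
  exact hne (hi x _ hxH)

/-- At some stage `s ∈ [n, t]`, the number `t` has the value `i` in each of the first `n` sets of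
the sequence `X` whose index is in the set approximated by `Y`. -/
def AgreesAt (X Y : Cantor) (i : Bool) (n t : ℕ) : Prop :=
  ∃ s < t + 1, n ≤ s ∧ ∀ x < n, pairFun Y x s = true → X (Nat.pair x t) = i

open Classical in
/-- The set whose elements are, for each `n`, the least `t` such that `AgreesAt X Y i n t`. -/
noncomputable def firstAgreements (X Y : Cantor) (i : Bool) : Cantor := fun t =>
  decide (∃ n < t + 1, AgreesAt X Y i n t ∧ ∀ t' < t, ¬ AgreesAt X Y i n t')

theorem computes_firstAgreements (X Y : Cantor) (i : Bool) :
    Computes (join X Y) (firstAgreements X Y i) := by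
  classical
  have hA : DecidableIn (join X Y) fun a : ℕ × ℕ => AgreesAt X Y i a.1 a.2 := by
    refine DecidableIn.exists_lt (p := fun (a : ℕ × ℕ) s => a.1 ≤ s ∧
      ∀ x < a.1, pairFun Y x s = true → X (Nat.pair x a.2) = i) ?_ (Primrec.succ.comp Primrec.snd)
    refine (DecidableIn.of_primrecPred (Primrec.nat_le.comp
      (Primrec.fst.comp Primrec.fst) Primrec.snd)).and ?_
    refine DecidableIn.forall_lt (p := fun (a : (ℕ × ℕ) × ℕ) x =>
      pairFun Y x a.2 = true → X (Nat.pair x a.1.2) = i) ?_ (Primrec.fst.comp Primrec.fst)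
    exact ((computes_join_right X Y).decidableIn.comp
      (Primrec₂.natPair.comp Primrec.snd (Primrec.snd.comp Primrec.fst))).imp
      (((computes_join_left X Y).decidableIn.apply_eq i).comp
        (Primrec₂.natPair.comp Primrec.snd
          (Primrec.snd.comp (Primrec.fst.comp Primrec.fst))))
  have h : DecidableIn (join X Y) fun t : ℕ =>
      ∃ n < t + 1, AgreesAt X Y i n t ∧ ∀ t' < t, ¬ AgreesAt X Y i n t' := by
    refine DecidableIn.exists_lt (p := fun t n =>
      AgreesAt X Y i n t ∧ ∀ t' < t, ¬ AgreesAt X Y i n t') ?_ Primrec.succ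
    refine (hA.comp (Primrec.pair Primrec.snd Primrec.fst)).and ?_
    exact DecidableIn.forall_lt (p := fun (a : ℕ × ℕ) t' => ¬ AgreesAt X Y i a.2 t')
      (hA.not.comp (Primrec.pair (Primrec.snd.comp Primrec.fst) Primrec.snd)) Primrec.fst
  convert h.computes using 1
  exact funext fun n => decide_eq_decide.2 Iff.rfl

theorem exists_agreesAt {X Y H : Cantor} {i : Bool} (hJ : JI.IsSolution H Y)
    (hi : ∀ n, ∃ σ ∈ patternTree X, σ.length = n ∧
      ∀ (x : ℕ) (hx : x < σ.length), x ∈ toSet H → σ[x] = i) (n : ℕ) :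
    ∃ t, AgreesAt X Y i n t := by
  have hlim : ∀ᶠ s in atTop, ∀ x ∈ Set.Iio n, pairFun Y x s = H x := by
    rw [eventually_all_finite (Set.finite_Iio n)]
    exact fun x _ => hJ x
  -- At this `s` the approximation is correct below `n`. A string of length `s` in the tree has a
  -- witness `y ≥ s`, so `t = y` meets the bound on the stage.
  obtain ⟨s, hs, hns⟩ := (hlim.and (eventually_ge_atTop n)).exists
  obtain ⟨σ, ⟨y, hy, hσ⟩, rfl, hH⟩ := hi s
  exact ⟨y, σ.length, by omega, hns, fun x hx hxY => by
    have hx' : x < σ.length := hx.trans_le hns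
    rw [hσ x hx']
    exact hH x hx' ((hs x hx).symm.trans hxY)⟩

theorem RCOH_reducible_comp_JI_RWKL' : CompReducible RCOH (JI.comp RWKL') := by
  classical
  intro X _
  refine ⟨patternApprox X, computes_patternApprox X,
    comp_JI_RWKL'_isInstance_patternApprox X, ?_⟩
  rintro Y ⟨H, ⟨-, hH, hhom⟩, hJ⟩
  rw [limitTree_patternApprox] at hhom
  obtain ⟨i, hi⟩ := hhom.exists_value (isTree_patternTree X)
  have hex := exists_agreesAt hJ hi
  -- Hence the bound `n < t + 1` in `firstAgreements` loses nothing, and the least agreements are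
  -- unbounded.
  have hge : ∀ {n t}, AgreesAt X Y i n t → n ≤ t := by
    rintro n t ⟨s, hs, hns, -⟩
    omega
  refine ⟨firstAgreements X Y i, computes_firstAgreements X Y i, ?_, hH.mono fun x hx => ?_⟩
  · refine Set.infinite_of_forall_exists_gt fun n => ?_
    have h := Nat.find_spec (hex (n + 1))
    refine ⟨Nat.find (hex (n + 1)), ?_, hge h⟩
    simp only [toSet, firstAgreements, Set.mem_ofPred_eq, decide_eq_true_eq]
    exact ⟨n + 1, Nat.lt_succ_of_le (hge h), h, fun t' => Nat.find_min _⟩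
  · have hlim : ∀ᶠ s in atTop, pairFun Y x s = true := by
      filter_upwards [hJ x] with s hs
      exact hs.trans hx
    obtain ⟨N, hN⟩ := eventually_atTop.1 hlim
    -- Outside this finite image, `t` comes from some `n > max x N`; its stage `s ≥ n` is past `N`,
    -- so `x` is recognised as a member of `H`.
    have key : ∀ t ∈ toSet (firstAgreements X Y i) \
        (fun n => Nat.find (hex n)) '' Set.Iic (max x N), X (Nat.pair x t) = i := by
      rintro t ⟨ht, htF⟩
      simp only [toSet, firstAgreements, Set.mem_ofPred_eq, decide_eq_true_eq] at ht
      obtain ⟨n, -, hA, hmin⟩ := ht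
      have hn : max x N < n := not_le.1 fun hn => htF ⟨n, hn, (Nat.find_eq_iff _).2 ⟨hA, hmin⟩⟩
      obtain ⟨s, -, hns, h⟩ := hA
      exact h x (by omega) (hN s (by omega))
    have hfin := (Set.finite_Iic (max x N)).image fun n => Nat.find (hex n)
    cases i
    · exact Or.inr ⟨_, hfin, fun t ht => Bool.eq_false_iff.1 (key t ht)⟩
    · exact Or.inl ⟨_, hfin, fun t ht => key t ht⟩

end RamseyCoh

theorem mainTheorem4 :
    RamseyCoh.CompEquiv (RamseyCoh.Problem.comp RamseyCoh.JI RamseyCoh.RWKL') RamseyCoh.RCOH :=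
  ⟨RamseyCoh.comp_JI_RWKL'_reducible_RCOH, RamseyCoh.RCOH_reducible_comp_JI_RWKL'⟩
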